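/- Let $n\ge 3$ and let $\mathcal P=\mathbb C[x_{ij} : 1\le i\le n,\ 1\le j\le 3]$ be the algebra of polynomial functions on the space $\mathrm M_{n,3}(\mathbb C)$ of complex $n\times 3$ matrices, with the action of $\mathrm{GL}_n\times\mathrm{GL}_3$ given by $((g,h).f)(X)=f(g^{t}Xh)$. For $m\ge 0$ let $\mathcal Q_m=\mathcal P_{(m,m,m)}$ be the space of all $f\in\mathcal P$ with $(1,t).f=(t_1t_2t_3)^m f$ for every invertible diagonal matrix $t=\mathrm{diag}(t_1,t_2,t_3)$, and let $\mathcal Q=\bigoplus_{m\ge 0}\mathcal Q_m$, a subalgebra of $\mathcal P$. Let $U_n\subset\mathrm{GL}_n$ be the group of upper triangular matrices with all diagonal entries equal to $1$, and let $\mathcal Q^{U_n}$ be the algebra of $U_n$-invariants in $\mathcal Q$. For $1\le i_1<\dots<i_s\le 3$ write $\delta_{i_1\cdots i_s}=\det(x_{p,i_q})_{1\le p,q\le s}$, and put $$\alpha_1=x_{11}x_{12}x_{13},\quad \beta_2=x_{13}\delta_{12},\quad \beta_3=x_{12}\delta_{13},\quad \gamma_1=\delta_{123},\quad \gamma_2=\delta_{12}\delta_{13}\delta_{23}.$$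 For a semistandard Young tableau $T$ with entries in $\{1,2,3\}$ and columns $T_1,\dots,T_p$, let $\delta_T=\delta_{T_1}\cdots\delta_{T_p}$, where $\delta_{T_c}=\delta_{i_1\cdots i_s}$ if the entries of the column $T_c$ are $i_1<\dots<i_s$. Then: 1. The $\mathbb C$-algebra $\mathcal Q^{U_n}$ is generated by $\alpha_1,\beta_2,\beta_3,\gamma_1,\gamma_2$. 2. For every $m\ge 0$ and every semistandard Young tableau $T$ of content $(m,m,m)$ (each of $1,2,3$ occurs exactly $m$ times), of any shape, there are non-negative integers $a,b_2,b_3,c_1,c_2$ with $\delta_T=\alpha_1^{a}\beta_2^{b_2}\beta_3^{b_3}\gamma_1^{c_1}\gamma_2^{c_2}$. -/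

import Mathlib

noncomputable section

open MvPolynomial

namespace Plethysm

/-- The algebra `𝒫 = 𝒫(M_{n,k})` of polynomial functions on complex `n × k` matrices,
identified with the polynomial ring in the coordinate functions `x_{ij}`. -/
abbrev P (n k : ℕ) : Type := MvPolynomial (Fin n × Fin k) ℂ

/-- The action of `GL_n × GL_k` on `𝒫`, `((g, h) • f)(X) = f(gᵗ X h)`: substitute for `x_{ij}`
the `(i, j)` entry `∑ s t, g_{si} x_{st} h_{tj}` of `gᵗ X h`. -/
def act {n k : ℕ} (g : GL (Fin n) ℂ) (h : GL (Fin k) ℂ) : P n k →ₐ[ℂ] P n k :=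
  aeval fun ij : Fin n × Fin k =>
    ∑ s : Fin n, ∑ t : Fin k, C (g.1 s ij.1 * h.1 t ij.2) * X (s, t)

/-- The element `diag(t_1, …, t_k)` of the diagonal torus `A_k` of `GL_k`. -/
def torus {k : ℕ} (t : Fin k → ℂˣ) : GL (Fin k) ℂ where
  val := Matrix.diagonal fun j => (t j : ℂ)
  inv := Matrix.diagonal fun j => ((t j)⁻¹ : ℂˣ)
  val_inv := by simp [Matrix.diagonal_mul_diagonal]
  inv_val := by simp [Matrix.diagonal_mul_diagonal]

/-- The group `U_n` of upper triangular matrices with all diagonal entries `1`. -/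
def U (n : ℕ) : Subgroup (GL (Fin n) ℂ) where
  carrier := {g | (∀ i j, j < i → g.1 i j = 0) ∧ ∀ i, g.1 i i = 1}
  one_mem' := by
    refine ⟨fun i j h => ?_, fun i => ?_⟩
    · simp [h.ne']
    · simp
  mul_mem' := by
    rintro a b ⟨ha, ha'⟩ ⟨hb, hb'⟩
    refine ⟨fun i j hij => ?_, fun i => ?_⟩
    · rw [Units.val_mul, Matrix.mul_apply]
      refine Finset.sum_eq_zero fun s _ => ?_
      rcases lt_or_ge s i with h | h
      · rw [ha i s h, zero_mul]
      · rw [hb s j (hij.trans_le h), mul_zero]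
    · rw [Units.val_mul, Matrix.mul_apply, Finset.sum_eq_single i]
      · rw [ha', hb', one_mul]
      · intro s _ hs
        rcases lt_or_gt_of_ne hs with h | h
        · rw [ha i s h, zero_mul]
        · rw [hb s i h, mul_zero]
      · simp
  inv_mem' := by
    rintro a ⟨ha, ha'⟩
    have htri : Matrix.BlockTriangular a.1 id := fun i j h => ha i j h
    have : Invertible a.1 := a.invertible
    have hinv : ∀ i j, j < i → (a⁻¹).1 i j = 0 := by
      intro i j h
      have := Matrix.blockTriangular_inv_of_blockTriangular htri
      rw [Matrix.coe_units_inv]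
      exact this h
    refine ⟨hinv, fun i => ?_⟩
    have h1 : (a.1 * (a⁻¹).1) i i = 1 := by simp
    rw [Matrix.mul_apply, Finset.sum_eq_single i] at h1
    · rwa [ha', one_mul] at h1
    · intro s _ hs
      rcases lt_or_gt_of_ne hs with h | h
      · rw [ha i s h, zero_mul]
      · rw [hinv s i h, mul_zero]
    · simp

/-- The homogeneous component `𝒫_𝐦`: the torus `A_k` acts by the character
`t ↦ t_1^{m_1} ⋯ t_k^{m_k}`. -/
def weightSpace (n : ℕ) {k : ℕ} (w : Fin k → ℕ) : Submodule ℂ (P n k) where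
  carrier := {f | ∀ t : Fin k → ℂˣ, act 1 (torus t) f = (∏ j, (t j : ℂ) ^ w j) • f}
  zero_mem' := by intro t; simp
  add_mem' := by
    intro a b ha hb t
    rw [map_add, ha t, hb t, smul_add]
  smul_mem' := by
    intro c a ha t
    rw [map_smul, ha t, smul_comm]

/-- `𝒬_m = 𝒫_{(m, …, m)}`. -/
def Qm (n k m : ℕ) : Submodule ℂ (P n k) := weightSpace n fun _ : Fin k => m

theorem Qm_mul {n k a b : ℕ} {f g : P n k} (hf : f ∈ Qm n k a) (hg : g ∈ Qm n k b) :
    f * g ∈ Qm n k (a + b) := by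
  intro t
  rw [map_mul, hf t, hg t, smul_mul_smul_comm, ← Finset.prod_mul_distrib]
  simp only [pow_add]

theorem one_mem_Qm (n k : ℕ) : (1 : P n k) ∈ Qm n k 0 := by
  intro t
  simp

/-- The algebra `𝒬`, the sum of the components `𝒬_m` in `𝒫`, a subalgebra of `𝒫`. -/
def Q (n k : ℕ) : Subalgebra ℂ (P n k) :=
  (⨆ m, Qm n k m).toSubalgebra
    (Submodule.mem_iSup_of_mem 0 (one_mem_Qm n k))
    (by
      intro f g hf hg
      induction hf using Submodule.iSup_induction' with
      | zero => rw [zero_mul]; exact Submodule.zero_mem _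
      | add x y _ _ hx hy => rw [add_mul]; exact Submodule.add_mem _ hx hy
      | mem a x hx =>
        induction hg using Submodule.iSup_induction' with
        | zero => rw [mul_zero]; exact Submodule.zero_mem _
        | add y z _ _ hy hz => rw [mul_add]; exact Submodule.add_mem _ hy hz
        | mem b y hy => exact Submodule.mem_iSup_of_mem (a + b) (Qm_mul hx hy))

/-- The algebra `𝒬^{U_n}` of `U_n`-invariants in `𝒬`. -/
def QU (n k : ℕ) : Subalgebra ℂ (P n k) where
  carrier := {f | f ∈ Q n k ∧ ∀ u ∈ U n, act u 1 f = f}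
  mul_mem' := by
    rintro a b ⟨ha, ha'⟩ ⟨hb, hb'⟩
    exact ⟨mul_mem ha hb, fun u hu => by rw [map_mul, ha' u hu, hb' u hu]⟩
  add_mem' := by
    rintro a b ⟨ha, ha'⟩ ⟨hb, hb'⟩
    exact ⟨add_mem ha hb, fun u hu => by rw [map_add, ha' u hu, hb' u hu]⟩
  algebraMap_mem' := fun c => ⟨Subalgebra.algebraMap_mem _ c, fun u _ => AlgHom.commutes _ c⟩

/-- The coordinate function `x_{ij}`, with the usual indices `1 ≤ i ≤ n`, `1 ≤ j ≤ k`
(the value is `0` for indices out of range, which do not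
occur in the minors of tableaux with entries in `{1, …, k}` when `k ≤ n`). -/
def x (n k : ℕ) (i j : ℕ) : P n k :=
  if h : (1 ≤ i ∧ i ≤ n) ∧ (1 ≤ j ∧ j ≤ k) then X (⟨i - 1, by omega⟩, ⟨j - 1, by omega⟩) else 0

/-- The minor `det (x_{p, i_q})_{1 ≤ p, q ≤ s}` on the rows `1, …, s` and the columns
`i_1, …, i_s`. -/
def minor (n k : ℕ) {s : ℕ} (I : Fin s → ℕ) : P n k :=
  (Matrix.of fun p q : Fin s => x n k (p + 1) (I q)).det

/-- `T` has content `w`: its entries lie in `{1, …, k}`, and `j` occurs `w_j` times. -/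
def HasContent {μ : YoungDiagram} (T : SemistandardYoungTableau μ) {k : ℕ} (w : Fin k → ℕ) :
    Prop :=
  (∀ c ∈ μ.cells, 1 ≤ T c.1 c.2 ∧ T c.1 c.2 ≤ k) ∧
    ∀ j : Fin k, (μ.cells.filter fun c => T c.1 c.2 = (j : ℕ) + 1).card = w j

/-- `δ_T`, the product over the columns of `T` of the minors given by the entries of the column. -/
def deltaT (n k : ℕ) {μ : YoungDiagram} (T : SemistandardYoungTableau μ) : P n k :=
  ∏ c ∈ Finset.range (μ.rowLen 0), minor n k fun p : Fin (μ.colLen c) => T p c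

/-- `α₁ = x₁₁ x₁₂ x₁₃`. -/
def α₁ (n : ℕ) : P n 3 := x n 3 1 1 * x n 3 1 2 * x n 3 1 3

/-- `β₂ = x₁₃ δ₁₂`. -/
def β₂ (n : ℕ) : P n 3 := x n 3 1 3 * minor n 3 ![1, 2]

/-- `β₃ = x₁₂ δ₁₃`. -/
def β₃ (n : ℕ) : P n 3 := x n 3 1 2 * minor n 3 ![1, 3]

/-- `γ₁`, the determinant of `(x_{ij})_{1 ≤ i, j ≤ 3}`. -/
def γ₁ (n : ℕ) : P n 3 := minor n 3 ![1, 2, 3]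

/-- `γ₂ = δ₁₂ δ₁₃ δ₂₃`. -/
def γ₂ (n : ℕ) : P n 3 := minor n 3 ![1, 2] * minor n 3 ![1, 3] * minor n 3 ![2, 3]

end Plethysm

end

/-! That the five generators are invariants of balanced column weight is a direct check
(`adjoin_le_QU`). For the converse, split an invariant into pieces of weight m that are homogeneous
of degrees s and l in the second and third rows (rows 1 and 2 in the code). A generic matrix is a
lower unipotent matrix times an upper triangular one, and row and column scalings bring the latter
to rows (1,1,1), (0,1,w), (0,0,1) with w = β₃/β₂. Such a piece is therefore governed by one
univariate polynomial g, its restriction to this line of matrices (`ev_eq_of_multihomogeneous`):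
generically f = α₁^(m-s) β₂^(s-l) γ₁^l g(β₃/β₂).

Since f is a polynomial, this expression has no poles. Testing it on four curves
(`exists_section_polynomial`) gives deg g + l ≤ min(m, s), and w^r (w-1)^r ∣ g when s = m + r. If s
≤ m, the formula is already a polynomial in the generators. If s = m + r, the relation α₁γ₂ =
β₂β₃(β₃ - β₂), which follows from x₁₁δ₂₃ = x₁₂δ₁₃ - x₁₃δ₁₂, turns the factor w^r (w-1)^r into γ₂^r
and cancels the negative power of α₁ (`mem_adjoin_of_multihomogeneous`).

For tableaux only the multiplicities of the seven possible columns matter. Semistandardness forbids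
the columns {1} and {2,3} from occurring together, and equal content then forces the remaining
columns to group into generators (`exists_deltaT_eq`). -/

namespace Plethysm

/-! ### Zeros and degrees of univariate polynomials from behaviour at t = 0. -/

section Univariate
open Polynomial

theorem polynomial_eq_of_eval_eq_of_ne_zero {p q : ℂ[X]}
    (h : ∀ t : ℂ, t ≠ 0 → p.eval t = q.eval t) : p = q :=
  Polynomial.eq_of_infinite_eval_eq p q
    ((Set.finite_singleton (0 : ℂ)).infinite_compl.mono fun t ht => h t ht)

/-- The relation holds for infinitely many t, hence as polynomials; cancelling X^m shows that X^r
divides g(X + a), and translation finishes. This turns regularity of an invariant along a curve into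
a zero of g at a. -/
theorem X_sub_C_pow_dvd_of_eval {p g : ℂ[X]} {a c : ℂ} {m r : ℕ} (hc : c ≠ 0)
    (h : ∀ t : ℂ, t ≠ 0 → p.eval t * t ^ (m + r) = c * t ^ m * g.eval (t + a)) :
    (X - C a) ^ r ∣ g := by
  have h1 : p * X ^ r * X ^ m = C c * g.comp (X + C a) * X ^ m :=
    polynomial_eq_of_eval_eq_of_ne_zero fun t ht => by
      have := h t ht
      simp only [eval_mul, eval_pow, eval_X, eval_C, eval_comp, eval_add]
      rw [pow_add] at this
      linear_combination this
  have h2 := mul_right_cancel₀ (pow_ne_zero m X_ne_zero) h1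
  have h3 := congrArg (fun q => C c⁻¹ * q.comp (X - C a)) h2
  simp only [mul_comp, pow_comp, X_comp, C_comp, comp_assoc, add_comp, sub_add_cancel,
    comp_X] at h3
  rw [← mul_assoc (C c⁻¹) (C c), ← C_mul, inv_mul_cancel₀ hc, C_1, one_mul] at h3
  exact ⟨C c⁻¹ * p.comp (X - C a), by rw [← h3]; ring⟩

/-- Multiplying by t^(deg g) replaces g(1/t) by the reversed polynomial. If the bound failed,
cancelling X^m would make the reversal vanish at 0, where its value is the leading coefficient of g.
-/
theorem natDegree_add_le_of_eval {p g : ℂ[X]} {c : ℂ} {m l : ℕ} (hc : c ≠ 0) (hg : g ≠ 0)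
    (h : ∀ t : ℂ, t ≠ 0 → p.eval t * t ^ l = c * t ^ m * g.eval t⁻¹) :
    g.natDegree + l ≤ m := by
  by_contra! hlt
  have h1 : p * X ^ (g.natDegree + l) = C c * g.reverse * X ^ m :=
    polynomial_eq_of_eval_eq_of_ne_zero fun t ht => by
      have h2 := h t ht
      have : Invertible (t⁻¹) := invertibleOfNonzero (inv_ne_zero ht)
      have h3 := eval₂_reverse_mul_pow (RingHom.id ℂ) t⁻¹ g
      rw [invOf_eq_inv, inv_inv, inv_pow, ← eval, ← eval] at h3
      simp only [eval_mul, eval_pow, eval_X, eval_C]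
      rw [pow_add, mul_comm (t ^ _), ← mul_assoc, h2, ← h3]
      field_simp
  have h4 : p * X ^ (g.natDegree + l - m) = C c * g.reverse := by
    refine mul_right_cancel₀ (pow_ne_zero m X_ne_zero) ?_
    rw [← h1, mul_assoc, ← pow_add]
    congr 2
    omega
  have h5 := congrArg (fun q => q.eval 0) h4
  simp only [eval_mul, eval_pow, eval_X, eval_C, ← coeff_zero_eq_eval_zero,
    coeff_zero_reverse] at h5
  rw [zero_pow (by omega), mul_zero] at h5
  exact mul_ne_zero hc (leadingCoeff_ne_zero.2 hg) h5.symm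

end Univariate

/-! ### Evaluation at matrices and decomposition into homogeneous components. -/

open MvPolynomial

/-- The value of a polynomial function at a matrix. -/
def ev {n k : ℕ} (A : Matrix (Fin n) (Fin k) ℂ) : P n k →ₐ[ℂ] ℂ :=
  aeval fun ij => A ij.1 ij.2

theorem ev_X {n k : ℕ} (A : Matrix (Fin n) (Fin k) ℂ) (i : Fin n) (j : Fin k) :
    ev A (X (i, j)) = A i j := by
  simp [ev]

theorem ev_act {n k : ℕ} (A : Matrix (Fin n) (Fin k) ℂ) (g : GL (Fin n) ℂ) (h : GL (Fin k) ℂ)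
    (f : P n k) : ev A (act g h f) = ev (g.1.transpose * A * h.1) f := by
  have : (ev A).comp (act g h) = ev (g.1.transpose * A * h.1) := by
    ext ij
    simp only [act, ev, AlgHom.comp_apply, aeval_X, map_sum, map_mul, Matrix.mul_apply,
      Matrix.transpose_apply, Finset.sum_mul, ← algebraMap_eq, AlgHom.commutes]
    rw [Finset.sum_comm]
    refine Finset.sum_congr rfl fun t _ => Finset.sum_congr rfl fun s _ => ?_
    simp only [Algebra.algebraMap_self, RingHom.id_apply]
    ring
  exact DFunLike.congr_fun this f

theorem ev_ext {n k : ℕ} {f g : P n k} (h : ∀ A, ev A f = ev A g) : f = g := by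
  refine MvPolynomial.funext fun v => ?_
  have := h (Matrix.of fun i j => v (i, j))
  simpa [ev, aeval_eq_eval] using this

/-- Polynomials that agree where a nonzero polynomial does not vanish are equal. -/
theorem ev_ext_of_ne_zero {n k : ℕ} {f g d : P n k} (hd : d ≠ 0)
    (h : ∀ A, ev A d ≠ 0 → ev A f = ev A g) : f = g := by
  refine mul_left_cancel₀ hd (ev_ext fun A => ?_)
  by_cases hA : ev A d = 0
  · simp [hA]
  · simp [h A hA]

theorem eq_zero_of_sum_pow_mul_eq_zero {S : Finset ℕ} {a : ℕ → ℂ}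
    (h : ∀ t : ℂˣ, ∑ d ∈ S, (t : ℂ) ^ d * a d = 0) : ∀ d ∈ S, a d = 0 := by
  intro d hd
  have h0 : (∑ d ∈ S, Polynomial.monomial d (a d)) = 0 := by
    refine Polynomial.eq_zero_of_infinite_isRoot _
      ((Set.finite_singleton (0 : ℂ)).infinite_compl.mono fun t ht => ?_)
    have := h (Units.mk0 t (by simpa using ht))
    simpa [Polynomial.eval_finsetSum, mul_comm, Units.val_mk0] using this
  have := congrArg (fun p => Polynomial.coeff p d) h0
  simpa [Polynomial.finsetSum_coeff, Polynomial.coeff_monomial, hd] using this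

theorem mem_Qm_iff {n k m : ℕ} {f : P n k} :
    f ∈ Qm n k m ↔ ∀ (t : Fin k → ℂˣ) (A : Matrix (Fin n) (Fin k) ℂ),
      ev (A * Matrix.diagonal fun j => (t j : ℂ)) f = (∏ j, (t j : ℂ)) ^ m * ev A f := by
  have key : ∀ t A, ev A (act 1 (torus t) f) = ev (A * Matrix.diagonal fun j => (t j : ℂ)) f := by
    intro t A
    rw [ev_act]
    simp [torus]
  constructor
  · intro h t A
    rw [← key, h t, map_smul, Finset.prod_pow, smul_eq_mul]
  · intro h t
    refine ev_ext fun A => ?_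
    rw [key, h, map_smul, Finset.prod_pow, smul_eq_mul]

/-- Invariance under the unipotent group, as a condition on values. -/
def UInv {n k : ℕ} (f : P n k) : Prop :=
  ∀ u ∈ U n, ∀ A, ev (u.1.transpose * A) f = ev A f

theorem UInv_iff {n k : ℕ} {f : P n k} : UInv f ↔ ∀ u ∈ U n, act u 1 f = f := by
  have key : ∀ u A, ev A (act u 1 f) = ev (u.1.transpose * A) f := by
    intro u A
    rw [ev_act]
    simp
  exact ⟨fun h u hu => ev_ext fun A => by rw [key, h u hu],
    fun h u hu A => by rw [← key, h u hu]⟩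

/-- `f` is homogeneous of degree `d` in the entries of row `i`. -/
def RowHom {n k : ℕ} (i : Fin n) (d : ℕ) (f : P n k) : Prop :=
  ∀ (q : ℂˣ) (A : Matrix (Fin n) (Fin k) ℂ),
    ev (Matrix.diagonal (Function.update 1 i (q : ℂ)) * A) f = (q : ℂ) ^ d * ev A f

theorem exists_row_expansion {n k : ℕ} (i : Fin n) (f : P n k) :
    ∃ (N : ℕ) (F : ℕ → P n k), ∀ (q : ℂ) A,
      ev (Matrix.diagonal (Function.update 1 i q) * A) f =
        ∑ d ∈ Finset.range N, q ^ d * ev A (F d) := by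
  let G : P n k →ₐ[ℂ] Polynomial (P n k) := aeval fun ij =>
    if ij.1 = i then Polynomial.C (X ij) * Polynomial.X else Polynomial.C (X ij)
  refine ⟨(G f).natDegree + 1, (G f).coeff, fun q A => ?_⟩
  have h1 : ∀ p : Polynomial (P n k), Polynomial.eval₂ (ev A : P n k →+* ℂ) q p =
      ∑ d ∈ Finset.range (p.natDegree + 1), q ^ d * ev A (p.coeff d) := by
    intro p
    rw [Polynomial.eval₂_eq_sum_range]
    simp [mul_comm]
  rw [← h1]
  let E : Polynomial (P n k) →+* ℂ := Polynomial.eval₂RingHom (ev A : P n k →+* ℂ) q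
  have : (ev (Matrix.diagonal (Function.update 1 i q) * A) : P n k →+* ℂ) =
      E.comp (G : P n k →+* Polynomial (P n k)) := by
    refine MvPolynomial.ringHom_ext (fun c => ?_) fun ⟨a, b⟩ => ?_
    · simp [E, G, ← algebraMap_eq]
    · rcases eq_or_ne a i with rfl | h
      · simp [E, G, ev, Matrix.diagonal_mul, mul_comm q]
      · simp [E, G, ev, Matrix.diagonal_mul, h]
  exact DFunLike.congr_fun this f

/-- The torus normalizes `U n`, so scaling a row does not destroy unipotent invariance. -/
theorem diagonal_conj_mem_U {n : ℕ} (i : Fin n) (q : ℂˣ) {u : GL (Fin n) ℂ} (hu : u ∈ U n) :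
    ∃ v ∈ U n, Matrix.diagonal (Function.update 1 i (q : ℂ)) * u.1.transpose =
      v.1.transpose * Matrix.diagonal (Function.update 1 i (q : ℂ)) := by
  let D : GL (Fin n) ℂ := torus (Function.update (1 : Fin n → ℂˣ) i q)
  have hD : D.1 = Matrix.diagonal (Function.update 1 i (q : ℂ)) := by
    simp only [D, torus]
    congr 1
    ext j
    rcases eq_or_ne j i with rfl | h <;> simp [*]
  have hD' : (D⁻¹).1 = Matrix.diagonal fun j =>
      ((((Function.update 1 i q : Fin n → ℂˣ) j)⁻¹ : ℂˣ) : ℂ) := rfl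
  refine ⟨D⁻¹ * u * D, ⟨fun a b hab => ?_, fun a => ?_⟩, ?_⟩
  · simp [hD, hD', Matrix.diagonal_mul, Matrix.mul_diagonal, hu.1 a b hab]
  · rcases eq_or_ne a i with rfl | h <;>
      simp [Matrix.diagonal_mul, Matrix.mul_diagonal, hu.2, *]
  · rw [← hD]
    have hT : D.1.transpose = D.1 := by rw [hD, Matrix.diagonal_transpose]
    have hT' : (D⁻¹).1.transpose * D.1 = 1 := by
      have h := congrArg Matrix.transpose (Units.mul_inv D)
      rwa [Matrix.transpose_mul, hT, Matrix.transpose_one] at h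
    rw [Units.val_mul, Units.val_mul, Matrix.transpose_mul, Matrix.transpose_mul, hT,
      Matrix.mul_assoc, Matrix.mul_assoc, hT', Matrix.mul_one]

/-- The components of `f` that are homogeneous in row `i` inherit its column weight, its unipotent
invariance and its homogeneity in the other rows. -/
theorem exists_rowHom_decomp {n k m : ℕ} (i : Fin n) {f : P n k} (hm : f ∈ Qm n k m)
    (hU : UInv f) :
    ∃ (N : ℕ) (F : ℕ → P n k), f = ∑ d ∈ Finset.range N, F d ∧ ∀ d ∈ Finset.range N,
      F d ∈ Qm n k m ∧ UInv (F d) ∧ RowHom i d (F d) ∧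
        ∀ i' d', i' ≠ i → RowHom i' d' f → RowHom i' d' (F d) := by
  obtain ⟨N, F, hF⟩ := exists_row_expansion i f
  -- A relation that holds for f after every scaling q of row i passes to each component by
  -- comparing coefficients of powers of q.
  have key : ∀ {c : ℂ} {A A' : Matrix (Fin n) (Fin k) ℂ},
      (∀ q : ℂˣ, ev (Matrix.diagonal (Function.update 1 i (q : ℂ)) * A') f =
        c * ev (Matrix.diagonal (Function.update 1 i (q : ℂ)) * A) f) →
      ∀ d ∈ Finset.range N, ev A' (F d) = c * ev A (F d) := by
    intro c A A' h d hd
    have := eq_zero_of_sum_pow_mul_eq_zero (S := Finset.range N)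
      (a := fun d => ev A' (F d) - c * ev A (F d)) (fun q => by
        have := h q
        rw [hF, hF, Finset.mul_sum, ← sub_eq_zero, ← Finset.sum_sub_distrib] at this
        rw [← this]
        exact Finset.sum_congr rfl fun d _ => by ring) d hd
    exact sub_eq_zero.1 this
  refine ⟨N, F, ev_ext fun A => ?_, fun d hd => ⟨?_, ?_, ?_, ?_⟩⟩
  · have := hF 1 A
    rw [← Pi.one_apply (M := fun _ => ℂ) i, Function.update_eq_self] at this
    simpa using this
  · rw [mem_Qm_iff]
    intro t A
    refine key (fun q => ?_) d hd
    rw [← Matrix.mul_assoc, (mem_Qm_iff.1 hm)]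
  · intro u hu A
    rw [← one_mul (ev A (F d))]
    refine key (fun q => ?_) d hd
    obtain ⟨v, hv, h⟩ := diagonal_conj_mem_U i q hu
    rw [← Matrix.mul_assoc, h, Matrix.mul_assoc, hU v hv, one_mul]
  · intro q A
    have := eq_zero_of_sum_pow_mul_eq_zero (S := Finset.range N)
      (a := fun d => ev (Matrix.diagonal (Function.update 1 i (q : ℂ)) * A) (F d) -
        (q : ℂ) ^ d * ev A (F d)) (fun r => by
        have h1 := hF r (Matrix.diagonal (Function.update 1 i (q : ℂ)) * A)
        have h2 := hF (r * q) A
        have h3 : Matrix.diagonal (Function.update 1 i (r : ℂ)) *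
            (Matrix.diagonal (Function.update 1 i (q : ℂ)) * A) =
              Matrix.diagonal (Function.update 1 i ((r : ℂ) * q)) * A := by
          rw [← Matrix.mul_assoc, Matrix.diagonal_mul_diagonal]
          congr 2
          ext j
          rcases eq_or_ne j i with rfl | h <;> simp [*]
        rw [h3, h2, ← sub_eq_zero, ← Finset.sum_sub_distrib] at h1
        rw [← neg_eq_zero, ← h1, ← Finset.sum_neg_distrib]
        exact Finset.sum_congr rfl fun d _ => by ring) d hd
    exact sub_eq_zero.1 this
  · intro i' d' _ h q A
    refine key (fun r => ?_) d hd
    rw [← h q, ← Matrix.mul_assoc, ← Matrix.mul_assoc, Matrix.diagonal_mul_diagonal,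
      Matrix.diagonal_mul_diagonal]
    simp only [mul_comm]

/-- Scaling the first column alone by t multiplies the weight m component by t^m, so comparing
powers of t gives the invariance of each component. Having k + 1 columns guarantees a first one. -/
theorem exists_Qm_decomp {n k : ℕ} {f : P n (k + 1)} (hf : f ∈ QU n (k + 1)) :
    ∃ (S : Finset ℕ) (F : ℕ → P n (k + 1)), f = ∑ m ∈ S, F m ∧
      ∀ m ∈ S, F m ∈ Qm n (k + 1) m ∧ UInv (F m) := by
  obtain ⟨hQ, hU⟩ := hf
  rw [← UInv_iff] at hU
  obtain ⟨F, hF, hsum⟩ := (Submodule.mem_iSup_iff_exists_finsupp _ _).1 hQ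
  refine ⟨F.support, F, hsum.symm, fun m hm => ⟨hF m, fun u hu A => ?_⟩⟩
  have key : ∀ (t : ℂˣ) A, ev (A * Matrix.diagonal fun j =>
      ((Function.update 1 0 t : Fin (k + 1) → ℂˣ) j : ℂ)) f =
        ∑ m ∈ F.support, (t : ℂ) ^ m * ev A (F m) := by
    intro t A
    rw [← hsum, Finsupp.sum, map_sum]
    refine Finset.sum_congr rfl fun m _ => ?_
    rw [mem_Qm_iff.1 (hF m), Fin.prod_univ_succ]
    simp
  have := eq_zero_of_sum_pow_mul_eq_zero (S := F.support)
      (a := fun d => ev (u.1.transpose * A) (F d) - ev A (F d)) (fun t => by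
        have h := hU u hu (A * Matrix.diagonal fun j =>
          ((Function.update 1 0 t : Fin (k + 1) → ℂˣ) j : ℂ))
        rw [← Matrix.mul_assoc, key, key, ← sub_eq_zero, ← Finset.sum_sub_distrib] at h
        rw [← h]
        exact Finset.sum_congr rfl fun d _ => by ring) m hm
  exact sub_eq_zero.1 this

/-! ### Values of the generators in terms of matrix entries. -/

section Values
variable {k : ℕ} (A : Matrix (Fin (k + 3)) (Fin 3) ℂ)

/-- The minor of a matrix on the first two rows and the columns `i`, `j`. -/
def minor₂ (i j : Fin 3) : ℂ := A 0 i * A 1 j - A 0 j * A 1 i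

/-- The minor of a matrix on the rows `0`, `1`, `r`. -/
def minor₃ (r : Fin (k + 3)) : ℂ :=
  A 0 0 * A 1 1 * A r 2 - A 0 0 * A 1 2 * A r 1 - A 0 1 * A 1 0 * A r 2 +
    A 0 1 * A 1 2 * A r 0 + A 0 2 * A 1 0 * A r 1 - A 0 2 * A 1 1 * A r 0

theorem ev_x (i : Fin 3) (j : Fin 3) :
    ev A (x (k + 3) 3 (i + 1) (j + 1)) = A (Fin.castLE (by omega) i) j := by
  rw [x, dif_pos (by omega), ev_X]
  rfl

theorem ev_x1 (j : Fin 3) : ev A (x (k + 3) 3 1 (j + 1)) = A 0 j := ev_x A 0 j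

theorem ev_x2 (j : Fin 3) : ev A (x (k + 3) 3 2 (j + 1)) = A 1 j := ev_x A 1 j

theorem ev_x3 (j : Fin 3) : ev A (x (k + 3) 3 3 (j + 1)) = A 2 j := ev_x A 2 j

theorem ev_minor₂ (i j : Fin 3) :
    ev A (minor (k + 3) 3 ![(i : ℕ) + 1, (j : ℕ) + 1]) = minor₂ A i j := by
  simp [minor, minor₂, Matrix.det_fin_two, ev_x1, ev_x2]

theorem ev_γ₁ : ev A (γ₁ (k + 3)) = minor₃ A 2 := by
  have h0 := ev_x1 A 0
  have h1 := ev_x1 A 1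
  have h2 := ev_x1 A 2
  have h3 := ev_x2 A 0
  have h4 := ev_x2 A 1
  have h5 := ev_x2 A 2
  have h6 := ev_x3 A 0
  have h7 := ev_x3 A 1
  have h8 := ev_x3 A 2
  norm_num at h0 h1 h2 h3 h4 h5 h6 h7 h8
  simp [γ₁, minor, minor₃, Matrix.det_fin_three, h0, h1, h2, h3, h4, h5, h6, h7, h8]

theorem ev_α₁ : ev A (α₁ (k + 3)) = A 0 0 * A 0 1 * A 0 2 := by
  rw [α₁, map_mul, map_mul]
  exact congrArg₂ _ (congrArg₂ _ (ev_x1 A 0) (ev_x1 A 1)) (ev_x1 A 2)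

theorem ev_β₂ : ev A (β₂ (k + 3)) = A 0 2 * minor₂ A 0 1 := by
  rw [β₂, map_mul]
  exact congrArg₂ _ (ev_x1 A 2) (ev_minor₂ A 0 1)

theorem ev_β₃ : ev A (β₃ (k + 3)) = A 0 1 * minor₂ A 0 2 := by
  rw [β₃, map_mul]
  exact congrArg₂ _ (ev_x1 A 1) (ev_minor₂ A 0 2)

theorem ev_γ₂ : ev A (γ₂ (k + 3)) = minor₂ A 0 1 * minor₂ A 0 2 * minor₂ A 1 2 := by
  rw [γ₂, map_mul, map_mul]
  exact congrArg₂ _ (congrArg₂ _ (ev_minor₂ A 0 1) (ev_minor₂ A 0 2)) (ev_minor₂ A 1 2)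

end Values

theorem mem_QU_of {n k m : ℕ} {f : P n k} (hm : f ∈ Qm n k m) (hU : UInv f) : f ∈ QU n k :=
  ⟨Submodule.mem_iSup_of_mem m hm, UInv_iff.1 hU⟩

/-! ### Invariance of the leading minors, and the easy inclusion. -/

section Unipotent
variable {k : ℕ} {u : GL (Fin (k + 3)) ℂ} (A : Matrix (Fin (k + 3)) (Fin 3) ℂ)

theorem transpose_mul_apply_zero (hu : u ∈ U (k + 3)) (j : Fin 3) :
    (u.1.transpose * A) 0 j = A 0 j := by
  rw [Matrix.mul_apply, Fin.sum_univ_succ]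
  simp [hu.2, hu.1 (Fin.succ _) 0 (Fin.succ_pos _)]

theorem transpose_mul_apply_one (hu : u ∈ U (k + 3)) (j : Fin 3) :
    (u.1.transpose * A) 1 j = u.1 0 1 * A 0 j + A 1 j := by
  have h : ∀ s : Fin (k + 1), u.1 s.succ.succ 1 = 0 := fun s =>
    hu.1 _ _ (by simp [Fin.lt_def])
  rw [Matrix.mul_apply, Fin.sum_univ_succ, Fin.sum_univ_succ]
  simp [hu.2, h]

theorem transpose_mul_apply_two (hu : u ∈ U (k + 3)) (j : Fin 3) :
    (u.1.transpose * A) 2 j = u.1 0 2 * A 0 j + u.1 1 2 * A 1 j + A 2 j := by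
  have h : ∀ s : Fin k, u.1 s.succ.succ.succ 2 = 0 := fun s =>
    hu.1 _ _ (by rw [Fin.lt_def, Fin.val_two]; simp)
  have h2 : (Fin.succ 1 : Fin (k + 3)) = 2 := rfl
  rw [Matrix.mul_apply, Fin.sum_univ_succ, Fin.sum_univ_succ, Fin.sum_univ_succ]
  simp [hu.2, h, h2, add_assoc]

theorem minor₂_transpose_mul (hu : u ∈ U (k + 3)) (i j : Fin 3) :
    minor₂ (u.1.transpose * A) i j = minor₂ A i j := by
  simp only [minor₂, transpose_mul_apply_zero A hu, transpose_mul_apply_one A hu]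
  ring

theorem minor₃_transpose_mul (hu : u ∈ U (k + 3)) :
    minor₃ (u.1.transpose * A) 2 = minor₃ A 2 := by
  simp only [minor₃, transpose_mul_apply_zero A hu, transpose_mul_apply_one A hu,
    transpose_mul_apply_two A hu]
  ring

end Unipotent

theorem α₁_mem_QU (k : ℕ) : α₁ (k + 3) ∈ QU (k + 3) 3 := by
  refine mem_QU_of (m := 1) (mem_Qm_iff.2 fun t A => ?_) fun u hu A => ?_
  · simp only [ev_α₁, Matrix.mul_diagonal, Fin.prod_univ_three]
    ring
  · simp only [ev_α₁, transpose_mul_apply_zero A hu]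

theorem β₂_mem_QU (k : ℕ) : β₂ (k + 3) ∈ QU (k + 3) 3 := by
  refine mem_QU_of (m := 1) (mem_Qm_iff.2 fun t A => ?_) fun u hu A => ?_
  · simp only [ev_β₂, minor₂, Matrix.mul_diagonal, Fin.prod_univ_three]
    ring
  · simp only [ev_β₂, transpose_mul_apply_zero A hu, minor₂_transpose_mul A hu]

theorem β₃_mem_QU (k : ℕ) : β₃ (k + 3) ∈ QU (k + 3) 3 := by
  refine mem_QU_of (m := 1) (mem_Qm_iff.2 fun t A => ?_) fun u hu A => ?_
  · simp only [ev_β₃, minor₂, Matrix.mul_diagonal, Fin.prod_univ_three]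
    ring
  · simp only [ev_β₃, transpose_mul_apply_zero A hu, minor₂_transpose_mul A hu]

theorem γ₁_mem_QU (k : ℕ) : γ₁ (k + 3) ∈ QU (k + 3) 3 := by
  refine mem_QU_of (m := 1) (mem_Qm_iff.2 fun t A => ?_) fun u hu A => ?_
  · simp only [ev_γ₁, minor₃, Matrix.mul_diagonal, Fin.prod_univ_three]
    ring
  · simp only [ev_γ₁, minor₃_transpose_mul A hu]

theorem γ₂_mem_QU (k : ℕ) : γ₂ (k + 3) ∈ QU (k + 3) 3 := by
  refine mem_QU_of (m := 2) (mem_Qm_iff.2 fun t A => ?_) fun u hu A => ?_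
  · simp only [ev_γ₂, minor₂, Matrix.mul_diagonal, Fin.prod_univ_three]
    ring
  · simp only [ev_γ₂, minor₂_transpose_mul A hu]

theorem adjoin_le_QU (k : ℕ) :
    Algebra.adjoin ℂ {α₁ (k + 3), β₂ (k + 3), β₃ (k + 3), γ₁ (k + 3), γ₂ (k + 3)} ≤
      QU (k + 3) 3 := by
  refine Algebra.adjoin_le ?_
  rintro f (rfl | rfl | rfl | rfl | rfl)
  exacts [α₁_mem_QU k, β₂_mem_QU k, β₃_mem_QU k, γ₁_mem_QU k, γ₂_mem_QU k]

/-! ### Normal form of a generic matrix under the group actions. -/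

/-- The matrix whose first three rows are given and whose other rows vanish. -/
def topRows {R : Type*} [CommRing R] (k : ℕ) (B : Matrix (Fin 3) (Fin 3) R) :
    Matrix (Fin (k + 3)) (Fin 3) R :=
  fun i j => if h : (i : ℕ) < 3 then B ⟨i, h⟩ j else 0

theorem topRows_zero {R : Type*} [CommRing R] (k : ℕ) (B : Matrix (Fin 3) (Fin 3) R) (j : Fin 3) :
    topRows k B 0 j = B 0 j := rfl

theorem topRows_one {R : Type*} [CommRing R] (k : ℕ) (B : Matrix (Fin 3) (Fin 3) R) (j : Fin 3) :
    topRows k B 1 j = B 1 j := rfl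

theorem topRows_two {R : Type*} [CommRing R] (k : ℕ) (B : Matrix (Fin 3) (Fin 3) R) (j : Fin 3) :
    topRows k B 2 j = B 2 j := rfl

/-- The restriction of a polynomial function to a polynomial curve of matrices. -/
theorem exists_eval_curve {k : ℕ} (f : P (k + 3) 3) (B : Matrix (Fin 3) (Fin 3) (Polynomial ℂ)) :
    ∃ p : Polynomial ℂ, ∀ t : ℂ, p.eval t = ev (topRows k (B.map (Polynomial.eval t))) f := by
  refine ⟨aeval (fun ij => topRows k B ij.1 ij.2) f, fun t => ?_⟩
  have : ((Polynomial.aeval t : Polynomial ℂ →ₐ[ℂ] ℂ)).comp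
      (aeval fun ij => topRows k B ij.1 ij.2) = ev (topRows k (B.map (Polynomial.eval t))) := by
    ext ij
    simp only [AlgHom.comp_apply, aeval_X, ev, topRows]
    split_ifs <;> simp [Polynomial.coe_aeval_eq_eval]
  rw [← this, AlgHom.comp_apply, Polynomial.coe_aeval_eq_eval]

/-- The matrix `L` of the factorization `A = L T` with `T` upper triangular. -/
noncomputable def lowerFactor {k : ℕ} (A : Matrix (Fin (k + 3)) (Fin 3) ℂ) :
    Matrix (Fin (k + 3)) (Fin (k + 3)) ℂ := fun i j =>
  if j = 0 then A i 0 / A 0 0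
  else if j = 1 then (A 0 0 * A i 1 - A 0 1 * A i 0) / minor₂ A 0 1
  else if j = 2 then minor₃ A i / minor₃ A 2
  else if i = j then 1 else 0

/-- Gaussian elimination with pivots written as quotients of leading minors. Columns of
`lowerFactor` beyond the third meet only zero rows of the second factor, so identity columns serve
there. -/
theorem exists_mem_U_factor {k : ℕ} (A : Matrix (Fin (k + 3)) (Fin 3) ℂ) (h0 : A 0 0 ≠ 0)
    (h1 : minor₂ A 0 1 ≠ 0) (h2 : minor₃ A 2 ≠ 0) :
    ∃ u ∈ U (k + 3), A = u.1.transpose * topRows k !![A 0 0, A 0 1, A 0 2;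
      0, minor₂ A 0 1 / A 0 0, minor₂ A 0 2 / A 0 0; 0, 0, minor₃ A 2 / minor₂ A 0 1] := by
  have hlow : ∀ i j, i < j → lowerFactor A i j = 0 := by
    intro i j hij
    unfold lowerFactor
    split_ifs with ha hb hc hd
    · subst ha; exact absurd hij (by simp)
    · subst hb
      obtain rfl : i = 0 := by
        apply Fin.ext
        simpa [Fin.lt_def] using hij
      ring
    · subst hc
      have : i = 0 ∨ i = 1 := by
        rw [Fin.lt_def, Fin.val_two] at hij
        rw [Fin.ext_iff, Fin.ext_iff, Fin.val_zero, Fin.val_one]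
        omega
      rcases this with rfl | rfl <;> simp only [minor₃] <;> ring
    · exact absurd hd hij.ne
    · rfl
  have hdiag : ∀ i, lowerFactor A i i = 1 := by
    intro i
    unfold lowerFactor
    split_ifs with ha hb hc
    · subst ha; exact div_self h0
    · subst hb; exact div_self h1
    · subst hc; exact div_self h2
    · rfl
    · contradiction
  have hdet : (lowerFactor A).transpose.det = 1 := by
    have h : (lowerFactor A).transpose.IsUpperTriangular := fun i j h => hlow j i h
    rw [Matrix.det_of_isUpperTriangular h]
    simp [hdiag]
  refine ⟨Matrix.GeneralLinearGroup.mk'' (lowerFactor A).transpose (by rw [hdet]; exact isUnit_one),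
    ⟨fun i j h => hlow j i h, fun i => hdiag i⟩, ?_⟩
  change A = (lowerFactor A).transpose.transpose * _
  rw [Matrix.transpose_transpose]
  have hs : (Fin.succ 1 : Fin (k + 3)) = 2 := rfl
  have ht : ∀ (B : Matrix (Fin 3) (Fin 3) ℂ) (i : Fin k) j, topRows k B i.succ.succ.succ j = 0 := by
    intro B i j
    simp [topRows]
  have l0 : ∀ i, lowerFactor A i 0 = A i 0 / A 0 0 := fun i => by simp [lowerFactor]
  have l1 : ∀ i, lowerFactor A i 1 = (A 0 0 * A i 1 - A 0 1 * A i 0) / minor₂ A 0 1 :=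
    fun i => by simp [lowerFactor]
  have l2 : ∀ i, lowerFactor A i 2 = minor₃ A i / minor₃ A 2 := fun i => by
    have h20 : (2 : Fin (k + 3)) ≠ 0 := by rw [Ne, Fin.ext_iff, Fin.val_two]; simp
    have h21 : (2 : Fin (k + 3)) ≠ 1 := by rw [Ne, Fin.ext_iff, Fin.val_two]; simp
    simp [lowerFactor, h20, h21]
  ext i j
  rw [Matrix.mul_apply, Fin.sum_univ_succ, Fin.sum_univ_succ, Fin.sum_univ_succ]
  simp only [ht, mul_zero, Finset.sum_const_zero, add_zero, Fin.succ_zero_eq_one, hs, topRows_zero,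
    topRows_one, topRows_two, l0, l1, l2]
  fin_cases j
  · simp
    field_simp
  · simp
    field_simp
    ring
  · simp
    field_simp
    simp only [minor₃, minor₂]
    ring

/-- The value of a multihomogeneous unipotent invariant at a generic matrix. -/
theorem ev_eq_of_multihomogeneous {k m s l : ℕ} {f : P (k + 3) 3} (hm : f ∈ Qm (k + 3) 3 m)
    (hU : UInv f) (hs : RowHom 1 s f) (hl : RowHom 2 l f)
    {A : Matrix (Fin (k + 3)) (Fin 3) ℂ} (h0 : A 0 0 ≠ 0) (h1 : A 0 1 ≠ 0) (h2 : A 0 2 ≠ 0)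
    (h3 : minor₂ A 0 1 ≠ 0) (h4 : minor₃ A 2 ≠ 0) :
    ev A f = (A 0 0 * A 0 1 * A 0 2) ^ m * (minor₂ A 0 1 / (A 0 0 * A 0 1)) ^ s *
      (minor₃ A 2 / (minor₂ A 0 1 * A 0 2)) ^ l *
        ev (topRows k !![1, 1, 1; 0, 1, minor₂ A 0 2 * A 0 1 / (minor₂ A 0 1 * A 0 2); 0, 0, 1])
          f := by
  obtain ⟨u, hu, hA⟩ := exists_mem_U_factor A h0 h3 h4
  -- Dividing the columns by the entries of the first row makes that row (1,1,1); y and z are the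
  -- remaining diagonal entries, and scaling them away leaves only w.
  let y : ℂˣ := Units.mk0 (minor₂ A 0 1 / (A 0 0 * A 0 1)) (by positivity)
  let z : ℂˣ := Units.mk0 (minor₃ A 2 / (minor₂ A 0 1 * A 0 2)) (by positivity)
  let d : Fin 3 → ℂˣ := ![Units.mk0 _ h0, Units.mk0 _ h1, Units.mk0 _ h2]
  have hd : (∏ j, (d j : ℂ)) = A 0 0 * A 0 1 * A 0 2 := by
    simp [d, Fin.prod_univ_three]
  have key := mem_Qm_iff.1 hm d (Matrix.diagonal (Function.update (1 : Fin (k + 3) → ℂ) 1 (y : ℂ)) *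
    (Matrix.diagonal (Function.update (1 : Fin (k + 3) → ℂ) 2 (z : ℂ)) * topRows k
      !![1, 1, 1; 0, 1, minor₂ A 0 2 * A 0 1 / (minor₂ A 0 1 * A 0 2); 0, 0, 1]))
  rw [hd, hs, hl] at key
  rw [mul_assoc, mul_assoc]
  refine Eq.trans ?_ key
  nth_rewrite 1 [hA]
  rw [hU u hu]
  congr 2
  ext i j
  rw [Matrix.mul_diagonal, Matrix.diagonal_mul, Matrix.diagonal_mul]
  have h20 : (2 : Fin (k + 3)) ≠ 0 := by rw [Ne, Fin.ext_iff, Fin.val_two]; simp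
  have h21 : (2 : Fin (k + 3)) ≠ 1 := by rw [Ne, Fin.ext_iff, Fin.val_two]; simp
  by_cases hi : (i : ℕ) < 3
  · have : i = 0 ∨ i = 1 ∨ i = 2 := by
      rw [Fin.ext_iff, Fin.ext_iff, Fin.ext_iff, Fin.val_zero, Fin.val_one, Fin.val_two]
      omega
    rcases this with rfl | rfl | rfl
    · rw [topRows_zero, topRows_zero]
      fin_cases j <;> simp [d, h20.symm]
    · rw [topRows_one, topRows_one]
      fin_cases j <;> simp [d, h21.symm, y] <;> field_simp
    · rw [topRows_two, topRows_two]
      fin_cases j <;> simp [d, h21, z] <;> field_simp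
  · simp [topRows, hi]

/-! ### Multihomogeneous invariants as polynomials in the generators. -/

section Multihomogeneous
variable {k m s l : ℕ} {f : P (k + 3) 3}

/-- The polynomial determining a multihomogeneous unipotent invariant, with its divisibility and
degree properties. -/
theorem exists_section_polynomial (hm : f ∈ Qm (k + 3) 3 m)
    (hU : UInv f) (hs : RowHom 1 s f) (hl : RowHom 2 l f) :
    ∃ g : Polynomial ℂ,
      (∀ w, g.eval w = ev (topRows k !![1, 1, 1; 0, 1, w; 0, 0, 1]) f) ∧
      (∀ r, s = m + r → Polynomial.X ^ r ∣ g ∧ (Polynomial.X - Polynomial.C 1) ^ r ∣ g) ∧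
      (g ≠ 0 → g.natDegree + l ≤ m ∧ g.natDegree + l ≤ s) := by
  obtain ⟨g, hg⟩ := exists_eval_curve f !![1, 1, 1; 0, 1, Polynomial.X; 0, 0, 1]
  -- On these four curves x₁₂, x₁₁, x₁₃ and δ₁₂, in this order, equal t up to sign, while w is t, t
  -- + 1, 1/t and 1/t. Each detects one possible pole of the generic formula at t = 0.
  obtain ⟨p, hp⟩ := exists_eval_curve f !![1, Polynomial.X, 1; 0, 1, 1; 0, 0, 1]
  obtain ⟨p', hp'⟩ := exists_eval_curve f !![Polynomial.X, 1, 1; 1, 0, -1; 0, 0, 1]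
  obtain ⟨q, hq⟩ := exists_eval_curve f !![1, 1, Polynomial.X; 0, 1, 1; 0, 0, 1]
  obtain ⟨q', hq'⟩ := exists_eval_curve f !![1, 1, 1; 0, Polynomial.X, 1; 0, 1, 0]
  have hmap : ∀ (t : ℂ) (a b c d e f' g' h i : Polynomial ℂ),
      (!![a, b, c; d, e, f'; g', h, i]).map (Polynomial.eval t) =
        !![a.eval t, b.eval t, c.eval t; d.eval t, e.eval t, f'.eval t;
          g'.eval t, h.eval t, i.eval t] := by
    intros
    ext i j
    fin_cases i <;> fin_cases j <;> rfl
  simp only [hmap, Polynomial.eval_X, Polynomial.eval_one, Polynomial.eval_zero,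
    Polynomial.eval_neg] at hg hp hp' hq hq'
  have main := fun A => ev_eq_of_multihomogeneous (A := topRows k A) hm hU hs hl
  simp only [← hg, minor₂, minor₃, topRows_zero, topRows_one, topRows_two] at main
  refine ⟨g, hg, ?_, fun hg0 => ⟨?_, ?_⟩⟩
  · rintro r rfl
    constructor
    · rw [← sub_zero (Polynomial.X : Polynomial ℂ), ← Polynomial.C_0]
      refine X_sub_C_pow_dvd_of_eval (p := p) (m := m) one_ne_zero fun t ht => ?_
      rw [hp, main _ (by simp) (by simpa) (by simp) (by simp) (by simp)]
      simp
      field_simp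
    -- The sign arises because δ₁₂ = -1 along this curve.
    · refine X_sub_C_pow_dvd_of_eval (p := p') (m := m) (c := (-1) ^ (m + r)) (by simp)
        fun t ht => ?_
      rw [hp', main _ (by simpa) (by simp) (by simp) (by simp) (by simp)]
      have : (-t - 1) / (-1) = t + 1 := by ring
      simp [this, div_pow]
      field_simp
  · refine natDegree_add_le_of_eval (p := q) (c := 1) one_ne_zero hg0 fun t ht => ?_
    rw [hq, main _ (by simp) (by simp) (by simpa) (by simp) (by simp)]
    simp
    field_simp
  -- The sign arises because γ₁ = -1 along this curve.
  · refine natDegree_add_le_of_eval (p := q') (c := (-1) ^ l) (by simp) hg0 fun t ht => ?_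
    rw [hq', main _ (by simp) (by simp) (by simp) (by simpa) (by simp)]
    simp [div_pow]
    field_simp

/-- The contribution of w^i to the generic formula, with denominators cleared; the bounds keep every
truncated exponent honest. -/
theorem monomial_identity_of_le {x₀ x₁ x₂ d e D : ℂ} (h0 : x₀ ≠ 0) (h1 : x₁ ≠ 0) (h2 : x₂ ≠ 0)
    (hd : d ≠ 0) {m s l i : ℕ} (hsm : s ≤ m) (hi : i + l ≤ s) :
    (x₀ * x₁ * x₂) ^ m * (d / (x₀ * x₁)) ^ s * (D / (d * x₂)) ^ l * (e * x₁ / (d * x₂)) ^ i =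
      (x₀ * x₁ * x₂) ^ (m - s) * (x₂ * d) ^ (s - l - i) * (x₁ * e) ^ i * D ^ l := by
  obtain ⟨a, rfl⟩ := Nat.exists_eq_add_of_le hsm
  obtain ⟨b, rfl⟩ := Nat.exists_eq_add_of_le hi
  rw [show i + l + b + a - (i + l + b) = a by omega, show i + l + b - l - i = b by omega]
  simp only [div_pow, mul_pow, pow_add]
  field_simp

/-- Here η stands for δ₂₃, and `hη` gives w - 1 = x₁₁δ₂₃/β₂. The r factors w(w - 1) absorb the
excess of s over m into γ₂^r. -/
theorem monomial_identity_of_ge {x₀ x₁ x₂ d e D η : ℂ} (h0 : x₀ ≠ 0) (h1 : x₁ ≠ 0)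
    (h2 : x₂ ≠ 0) (hd : d ≠ 0) (hη : x₀ * η = x₁ * e - x₂ * d) {m r l i : ℕ}
    (hi : i + 2 * r + l ≤ m) :
    (x₀ * x₁ * x₂) ^ m * (d / (x₀ * x₁)) ^ (m + r) * (D / (d * x₂)) ^ l *
        ((e * x₁ / (d * x₂)) ^ r * (e * x₁ / (d * x₂) - 1) ^ r * (e * x₁ / (d * x₂)) ^ i) =
      (d * e * η) ^ r * D ^ l * (x₁ * e) ^ i * (x₂ * d) ^ (m - l - 2 * r - i) := by
  obtain ⟨b, rfl⟩ := Nat.exists_eq_add_of_le hi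
  have hw : e * x₁ / (d * x₂) - 1 = x₀ * η / (d * x₂) := by
    rw [hη]
    field_simp
  rw [hw, show i + 2 * r + l + b - l - 2 * r - i = b by omega]
  simp only [div_pow, mul_pow, pow_add, two_mul]
  field_simp

/-- A polynomial that is nonzero exactly where the factorization `A = L T` is defined and the first
row has no zero entry. -/
noncomputable def genericDenominator (k : ℕ) : P (k + 3) 3 :=
  α₁ (k + 3) * β₂ (k + 3) * γ₁ (k + 3)

theorem ev_genericDenominator (A : Matrix (Fin (k + 3)) (Fin 3) ℂ) :
    ev A (genericDenominator k) =
      A 0 0 * A 0 1 * A 0 2 * (A 0 2 * minor₂ A 0 1) * minor₃ A 2 := by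
  rw [genericDenominator, map_mul, map_mul, ev_α₁, ev_β₂, ev_γ₁]

theorem genericDenominator_ne_zero (k : ℕ) : genericDenominator k ≠ 0 := by
  intro h
  have := ev_genericDenominator (topRows k !![1, 1, 1; 0, 1, 1; 0, 0, 1])
  rw [h, map_zero] at this
  simp [minor₂, minor₃, topRows_zero, topRows_one, topRows_two] at this

theorem mem_adjoin_of_multihomogeneous (hm : f ∈ Qm (k + 3) 3 m)
    (hU : UInv f) (hs : RowHom 1 s f) (hl : RowHom 2 l f) :
    f ∈ Algebra.adjoin ℂ {α₁ (k + 3), β₂ (k + 3), β₃ (k + 3), γ₁ (k + 3), γ₂ (k + 3)} := by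
  obtain ⟨g, hg, hdvd, hdeg⟩ := exists_section_polynomial hm hU hs hl
  have main : ∀ A, ev A (genericDenominator k) ≠ 0 →
      A 0 0 ≠ 0 ∧ A 0 1 ≠ 0 ∧ A 0 2 ≠ 0 ∧ minor₂ A 0 1 ≠ 0 ∧
      ev A f = (A 0 0 * A 0 1 * A 0 2) ^ m * (minor₂ A 0 1 / (A 0 0 * A 0 1)) ^ s *
        (minor₃ A 2 / (minor₂ A 0 1 * A 0 2)) ^ l *
          g.eval (minor₂ A 0 2 * A 0 1 / (minor₂ A 0 1 * A 0 2)) := by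
    intro A hA
    rw [ev_genericDenominator] at hA
    simp only [mul_ne_zero_iff] at hA
    obtain ⟨⟨⟨⟨h0, h1⟩, h2⟩, -, h3⟩, h4⟩ := hA
    exact ⟨h0, h1, h2, h3, by rw [hg, ev_eq_of_multihomogeneous hm hU hs hl h0 h1 h2 h3 h4]⟩
  set S : Set (P (k + 3) 3) := {α₁ (k + 3), β₂ (k + 3), β₃ (k + 3), γ₁ (k + 3), γ₂ (k + 3)}
    with hS
  have hα : α₁ (k + 3) ∈ Algebra.adjoin ℂ S := Algebra.subset_adjoin (by simp [hS])
  have hβ₂ : β₂ (k + 3) ∈ Algebra.adjoin ℂ S := Algebra.subset_adjoin (by simp [hS])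
  have hβ₃ : β₃ (k + 3) ∈ Algebra.adjoin ℂ S := Algebra.subset_adjoin (by simp [hS])
  have hγ₁ : γ₁ (k + 3) ∈ Algebra.adjoin ℂ S := Algebra.subset_adjoin (by simp [hS])
  have hγ₂ : γ₂ (k + 3) ∈ Algebra.adjoin ℂ S := Algebra.subset_adjoin (by simp [hS])
  rcases eq_or_ne g 0 with rfl | hg0
  · have : f = 0 := ev_ext_of_ne_zero (genericDenominator_ne_zero k) fun A hA => by
      rw [(main A hA).2.2.2.2]
      simp
    rw [this]
    exact zero_mem _
  obtain ⟨hdm, hds⟩ := hdeg hg0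
  rcases le_total s m with hsm | hsm
  · have : f = ∑ i ∈ Finset.range (g.natDegree + 1), g.coeff i •
        (α₁ (k + 3) ^ (m - s) * β₂ (k + 3) ^ (s - l - i) * β₃ (k + 3) ^ i * γ₁ (k + 3) ^ l) := by
      refine ev_ext_of_ne_zero (genericDenominator_ne_zero k) fun A hA => ?_
      obtain ⟨h0, h1, h2, h3, h⟩ := main A hA
      rw [h, map_sum, Polynomial.eval_eq_sum_range, Finset.mul_sum]
      refine Finset.sum_congr rfl fun i hi => ?_
      rw [Finset.mem_range] at hi
      simp only [map_smul, map_mul, map_pow, ev_α₁, ev_β₂, ev_β₃, ev_γ₁, smul_eq_mul]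
      rw [← monomial_identity_of_le h0 h1 h2 h3 hsm (by omega)]
      ring
    rw [this]
    exact sum_mem fun i _ => Subalgebra.smul_mem _ (mul_mem (mul_mem (mul_mem (pow_mem hα _)
      (pow_mem hβ₂ _)) (pow_mem hβ₃ _)) (pow_mem hγ₁ _)) _
  · obtain ⟨r, rfl⟩ := Nat.exists_eq_add_of_le hsm
    obtain ⟨hX, hX1⟩ := hdvd r rfl
    have hcop : IsCoprime ((Polynomial.X : Polynomial ℂ) ^ r)
        ((Polynomial.X - Polynomial.C 1) ^ r) := by
      refine IsCoprime.pow ⟨1, -1, ?_⟩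
      rw [Polynomial.C_1]
      ring
    obtain ⟨q, rfl⟩ := hcop.mul_dvd hX hX1
    have hq : q ≠ 0 := right_ne_zero_of_mul hg0
    rw [Polynomial.natDegree_mul (left_ne_zero_of_mul hg0) hq, Polynomial.natDegree_mul
      (pow_ne_zero _ Polynomial.X_ne_zero) (pow_ne_zero _ (Polynomial.X_sub_C_ne_zero 1)),
      Polynomial.natDegree_X_pow, Polynomial.natDegree_pow, Polynomial.natDegree_X_sub_C] at hdm
    have : f = ∑ i ∈ Finset.range (q.natDegree + 1), q.coeff i •
        (γ₂ (k + 3) ^ r * γ₁ (k + 3) ^ l * β₃ (k + 3) ^ i *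
          β₂ (k + 3) ^ (m - l - 2 * r - i)) := by
      refine ev_ext_of_ne_zero (genericDenominator_ne_zero k) fun A hA => ?_
      obtain ⟨h0, h1, h2, h3, h⟩ := main A hA
      rw [h, map_sum, Polynomial.eval_mul, Polynomial.eval_eq_sum_range (p := q), Finset.mul_sum,
        Finset.mul_sum]
      refine Finset.sum_congr rfl fun i hi => ?_
      rw [Finset.mem_range] at hi
      simp only [map_smul, map_mul, map_pow, ev_γ₂, ev_β₂, ev_β₃, ev_γ₁, smul_eq_mul]
      rw [← monomial_identity_of_ge h0 h1 h2 h3 (by simp only [minor₂]; ring) (by omega)]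
      simp only [Polynomial.eval_mul, Polynomial.eval_pow, Polynomial.eval_X,
        Polynomial.eval_sub, Polynomial.eval_C]
      ring
    rw [this]
    exact sum_mem fun i _ => Subalgebra.smul_mem _ (mul_mem (mul_mem (mul_mem (pow_mem hγ₂ _)
      (pow_mem hγ₁ _)) (pow_mem hβ₃ _)) (pow_mem hβ₂ _)) _

end Multihomogeneous

theorem QU_le_adjoin (k : ℕ) :
    QU (k + 3) 3 ≤
      Algebra.adjoin ℂ {α₁ (k + 3), β₂ (k + 3), β₃ (k + 3), γ₁ (k + 3), γ₂ (k + 3)} := by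
  intro f hf
  obtain ⟨S, F, rfl, hF⟩ := exists_Qm_decomp hf
  refine sum_mem fun m hm => ?_
  -- Only rows 1 and 2 need separating: column scalings normalize row 0, and the rows from index 3
  -- on vanish in the normal form.
  obtain ⟨N, G, hG, hG'⟩ := exists_rowHom_decomp 1 (hF m hm).1 (hF m hm).2
  rw [hG]
  refine sum_mem fun s hs => ?_
  obtain ⟨hGm, hGU, hGs, -⟩ := hG' s hs
  obtain ⟨N', H, hH, hH'⟩ := exists_rowHom_decomp 2 hGm hGU
  rw [hH]
  refine sum_mem fun l hl => ?_
  obtain ⟨hHm, hHU, hHl, hHs⟩ := hH' l hl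
  refine mem_adjoin_of_multihomogeneous hHm hHU (hHs 1 s ?_ hGs) hHl
  rw [Ne, Fin.ext_iff, Fin.val_two]
  simp

/-! ### Column multiplicities of tableaux. -/

/-- The seven minors that occur as columns of tableaux with entries in `{1, 2, 3}`. -/
noncomputable def columnMinor (n : ℕ) : Fin 7 → P n 3 :=
  ![minor n 3 ![1], minor n 3 ![2], minor n 3 ![3], minor n 3 ![1, 2], minor n 3 ![1, 3],
    minor n 3 ![2, 3], minor n 3 ![1, 2, 3]]

/-- The number of entries `j + 1` in the seven columns with entries in `{1, 2, 3}`. -/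
def columnContent : Fin 7 → Fin 3 → ℕ :=
  ![![1, 0, 0], ![0, 1, 0], ![0, 0, 1], ![1, 1, 0], ![1, 0, 1], ![0, 1, 1], ![1, 1, 1]]

/-- A strictly increasing column in {1,2,3} is a nonempty subset. The last two clauses keep the
length and top entry of {1} and {2,3}, the pair to be excluded later. -/
theorem exists_columnMinor (n : ℕ) {L : ℕ} {e : ℕ → ℕ} (hL : 0 < L)
    (hmem : ∀ p < L, 1 ≤ e p ∧ e p ≤ 3) (hinc : ∀ p q, p < q → q < L → e p < e q) :
    ∃ i : Fin 7, minor n 3 (fun p : Fin L => e p) = columnMinor n i ∧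
      (∀ j : Fin 3, ((Finset.range L).filter fun p => e p = j + 1).card = columnContent i j) ∧
      (i = 0 → L = 1 ∧ e 0 = 1) ∧ (i = 5 → L = 2 ∧ e 0 = 2) := by
  have hL3 : L ≤ 3 := by
    by_contra! h
    have h0 := hmem 0 (by omega)
    have h3 := hmem 3 (by omega)
    have := hinc 0 1 (by omega) (by omega)
    have := hinc 1 2 (by omega) (by omega)
    have := hinc 2 3 (by omega) (by omega)
    omega
  have hL' : L = 1 ∨ L = 2 ∨ L = 3 := by omega
  rcases hL' with rfl | rfl | rfl
  · have hv : (fun p : Fin 1 => e p) = ![e 0] := by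
      ext p
      fin_cases p
      rfl
    have h0 := hmem 0 (by omega)
    have h : e 0 = 1 ∨ e 0 = 2 ∨ e 0 = 3 := by omega
    rcases h with h | h | h
    · refine ⟨0, by rw [hv, h]; rfl, fun j => ?_, by simp [h], by simp⟩
      simp only [Finset.card_filter, Finset.sum_range_succ, Finset.sum_range_zero, h]
      fin_cases j <;> simp [columnContent]
    · refine ⟨1, by rw [hv, h]; rfl, fun j => ?_, by simp, by simp⟩
      simp only [Finset.card_filter, Finset.sum_range_succ, Finset.sum_range_zero, h]
      fin_cases j <;> simp [columnContent]
    · refine ⟨2, by rw [hv, h]; rfl, fun j => ?_, by simp, by simp⟩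
      simp only [Finset.card_filter, Finset.sum_range_succ, Finset.sum_range_zero, h]
      fin_cases j <;> simp [columnContent]
  · have hv : (fun p : Fin 2 => e p) = ![e 0, e 1] := by
      ext p
      fin_cases p <;> rfl
    have h0 := hmem 0 (by omega)
    have h1 := hmem 1 (by omega)
    have h01 := hinc 0 1 (by omega) (by omega)
    have h : (e 0 = 1 ∧ e 1 = 2) ∨ (e 0 = 1 ∧ e 1 = 3) ∨ (e 0 = 2 ∧ e 1 = 3) := by omega
    rcases h with ⟨h, h'⟩ | ⟨h, h'⟩ | ⟨h, h'⟩
    · refine ⟨3, by rw [hv, h, h']; rfl, fun j => ?_, by simp, by simp⟩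
      simp only [Finset.card_filter, Finset.sum_range_succ, Finset.sum_range_zero, h, h']
      fin_cases j <;> simp [columnContent]
    · refine ⟨4, by rw [hv, h, h']; rfl, fun j => ?_, by simp, by simp⟩
      simp only [Finset.card_filter, Finset.sum_range_succ, Finset.sum_range_zero, h, h']
      fin_cases j <;> simp [columnContent]
    · refine ⟨5, by rw [hv, h, h']; rfl, fun j => ?_, by simp, by simp [h]⟩
      simp only [Finset.card_filter, Finset.sum_range_succ, Finset.sum_range_zero, h, h']
      fin_cases j <;> simp [columnContent]
  · have hv : (fun p : Fin 3 => e p) = ![e 0, e 1, e 2] := by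
      ext p
      fin_cases p <;> rfl
    have h0 := hmem 0 (by omega)
    have h2 := hmem 2 (by omega)
    have h01 := hinc 0 1 (by omega) (by omega)
    have h12 := hinc 1 2 (by omega) (by omega)
    obtain ⟨h, h', h''⟩ : e 0 = 1 ∧ e 1 = 2 ∧ e 2 = 3 := by omega
    refine ⟨6, by rw [hv, h, h', h'']; rfl, fun j => ?_, by simp, by simp⟩
    simp only [Finset.card_filter, Finset.sum_range_succ, Finset.sum_range_zero, h, h', h'']
    fin_cases j <;> simp [columnContent]

theorem card_filter_cells (μ : YoungDiagram) (T : ℕ → ℕ → ℕ) (v : ℕ) :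
    (μ.cells.filter fun c => T c.1 c.2 = v).card =
      ∑ c ∈ Finset.range (μ.rowLen 0),
        ((Finset.range (μ.colLen c)).filter fun p => T p c = v).card := by
  rw [Finset.card_eq_sum_card_fiberwise (f := Prod.snd) (t := Finset.range (μ.rowLen 0))]
  · refine Finset.sum_congr rfl fun c _ => ?_
    refine Finset.card_nbij' Prod.fst (fun p => (p, c)) ?_ ?_ ?_ ?_
    · rintro ⟨p, c'⟩ h
      simp only [Finset.coe_filter, Finset.mem_filter, Set.mem_ofPred_eq, YoungDiagram.mem_cells,
        YoungDiagram.mem_iff_lt_colLen, Finset.mem_range] at h ⊢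
      obtain ⟨⟨h1, h2⟩, rfl⟩ := h
      exact ⟨h1, h2⟩
    · intro p h
      simp only [Finset.coe_filter, Finset.mem_filter, Set.mem_ofPred_eq, YoungDiagram.mem_cells,
        YoungDiagram.mem_iff_lt_colLen, Finset.mem_range] at h ⊢
      exact ⟨h, trivial⟩
    · rintro ⟨p, c'⟩ h
      simp only [Finset.coe_filter, Finset.mem_filter, Set.mem_ofPred_eq] at h
      rw [← h.2]
    · intro p _
      rfl
  · rintro ⟨p, c⟩ h
    simp only [Finset.coe_filter, Set.mem_ofPred_eq, YoungDiagram.mem_cells] at h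
    rw [Finset.mem_coe, Finset.mem_range, ← YoungDiagram.mem_iff_lt_rowLen]
    exact μ.up_left_mem (Nat.zero_le _) le_rfl h.1

theorem exists_column_multiplicities (n : ℕ) {w : Fin 3 → ℕ} {μ : YoungDiagram}
    (T : SemistandardYoungTableau μ) (hT : HasContent T w) :
    ∃ N : Fin 7 → ℕ, deltaT n 3 T = ∏ i, columnMinor n i ^ N i ∧
      (∀ j, ∑ i, N i * columnContent i j = w j) ∧ (N 0 = 0 ∨ N 5 = 0) := by
  have hex : ∀ c, ∃ i : Fin 7, c < μ.rowLen 0 →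
      minor n 3 (fun p : Fin (μ.colLen c) => T p c) = columnMinor n i ∧
      (∀ j : Fin 3, ((Finset.range (μ.colLen c)).filter fun p => T p c = j + 1).card =
        columnContent i j) ∧
      (i = 0 → μ.colLen c = 1 ∧ T 0 c = 1) ∧ (i = 5 → μ.colLen c = 2 ∧ T 0 c = 2) := by
    intro c
    by_cases hc : c < μ.rowLen 0
    · have hL : 0 < μ.colLen c := by
        rwa [← YoungDiagram.mem_iff_lt_colLen, YoungDiagram.mem_iff_lt_rowLen]
      obtain ⟨i, hi⟩ := exists_columnMinor n (e := fun p => T p c) hL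
        (fun p hp => hT.1 (p, c) (by
          rwa [YoungDiagram.mem_cells, YoungDiagram.mem_iff_lt_colLen]))
        (fun p q hpq hq => T.col_strict hpq (YoungDiagram.mem_iff_lt_colLen.2 hq))
      exact ⟨i, fun _ => hi⟩
    · exact ⟨0, fun h => absurd h hc⟩
  choose τ hτ using hex
  refine ⟨fun i => ((Finset.range (μ.rowLen 0)).filter fun c => τ c = i).card, ?_, fun j => ?_, ?_⟩
  · rw [deltaT, ← Finset.prod_fiberwise _ τ]
    refine Finset.prod_congr rfl fun i _ => ?_
    rw [← Finset.prod_const]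
    refine Finset.prod_congr rfl fun c hc => ?_
    rw [Finset.mem_filter, Finset.mem_range] at hc
    rw [(hτ c hc.1).1, hc.2]
  · rw [← hT.2 j, card_filter_cells μ (fun p c => T p c), ← Finset.sum_fiberwise _ τ]
    refine Finset.sum_congr rfl fun i _ => ?_
    rw [← smul_eq_mul, ← Finset.sum_const]
    refine Finset.sum_congr rfl fun c hc => ?_
    rw [Finset.mem_filter, Finset.mem_range] at hc
    rw [(hτ c hc.1).2.1, hc.2]
  -- Column lengths weakly decrease, so {1} cannot stand left of {2,3}; the top row weakly
  -- increases, so it cannot stand right of it.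
  · by_contra! h
    obtain ⟨c, hc⟩ := Finset.card_ne_zero.1 h.1
    obtain ⟨d, hd⟩ := Finset.card_ne_zero.1 h.2
    rw [Finset.mem_filter, Finset.mem_range] at hc hd
    obtain ⟨hc1, hc2⟩ := (hτ c hc.1).2.2.1 hc.2
    obtain ⟨hd1, hd2⟩ := (hτ d hd.1).2.2.2 hd.2
    rcases le_total c d with hcd | hcd
    · have := μ.colLen_anti c d hcd
      omega
    · have := T.row_weak_of_le hcd (YoungDiagram.mem_iff_lt_rowLen.2 hc.1)
      omega

theorem exists_deltaT_eq (n m : ℕ) (μ : YoungDiagram) (T : SemistandardYoungTableau μ)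
    (hT : HasContent T (fun _ : Fin 3 => m)) :
    ∃ a b₂ b₃ c₁ c₂ : ℕ,
      deltaT n 3 T = α₁ n ^ a * β₂ n ^ b₂ * β₃ n ^ b₃ * γ₁ n ^ c₁ * γ₂ n ^ c₂ := by
  obtain ⟨N, hN, hw, h⟩ := exists_column_multiplicities n T hT
  have hx : ∀ j, minor n 3 ![j] = x n 3 1 j := fun j => by simp [minor]
  have w0 := hw 0
  have w1 := hw 1
  have w2 := hw 2
  simp only [Fin.sum_univ_seven, columnContent] at w0 w1 w2
  simp at w0 w1 w2
  simp only [Fin.prod_univ_seven, columnMinor] at hN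
  simp only [Matrix.cons_val] at hN
  rw [hN, hx, hx, hx, α₁, β₂, β₃, γ₁, γ₂]
  -- Equal content means N 0 + N 4 = N 1 + N 5 and N 0 + N 3 = N 2 + N 5. If N 0 = 0, each {2,3} is
  -- grouped with a {1,2} and a {1,3} into γ₂; if N 5 = 0, each {1} is grouped with a {2} and a {3}
  -- into α₁. The other one- and two-entry columns pair into β₂ and β₃.
  rcases h with h | h
  · refine ⟨0, N 2, N 1, N 6, N 5, ?_⟩
    rw [h, show N 3 = N 2 + N 5 by omega, show N 4 = N 1 + N 5 by omega]
    ring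
  · refine ⟨N 0, N 3, N 4, N 6, 0, ?_⟩
    rw [h, show N 1 = N 0 + N 4 by omega, show N 2 = N 0 + N 3 by omega]
    ring

end Plethysm

theorem mainTheorem3 (n : ℕ) (hn : 3 ≤ n) :
    Plethysm.QU n 3 =
      Algebra.adjoin ℂ
        {Plethysm.α₁ n, Plethysm.β₂ n, Plethysm.β₃ n, Plethysm.γ₁ n, Plethysm.γ₂ n} ∧
    ∀ (m : ℕ) (μ : YoungDiagram) (T : SemistandardYoungTableau μ),
      Plethysm.HasContent T (fun _ : Fin 3 => m) →
        ∃ a b₂ b₃ c₁ c₂ : ℕ,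
          Plethysm.deltaT n 3 T =
            Plethysm.α₁ n ^ a * Plethysm.β₂ n ^ b₂ * Plethysm.β₃ n ^ b₃ *
              Plethysm.γ₁ n ^ c₁ * Plethysm.γ₂ n ^ c₂ := by
  refine ⟨?_, Plethysm.exists_deltaT_eq n⟩
  obtain ⟨k, rfl⟩ := Nat.exists_eq_add_of_le' hn
  exact le_antisymm (Plethysm.QU_le_adjoin k) (Plethysm.adjoin_le_QU k)
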